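/- A \emph{lattice} is a finitely generated free abelian group $M$ with a non-degenerate symmetric bilinear form $\langle\cdot,\cdot\rangle\colon M\times M\to\mathbb Z$; its discriminant group is $A_M=M^*/M$, where $M^*=\mathrm{Hom}(M,\mathbb Z)$. An \emph{$\mathcal E^*$-lattice} is a pair $(M,\rho)$ of a lattice $M$ and an isometry $\rho$ of $M$ with $\rho^3=1$ that has no non-zero fixed vector and acts trivially on $A_M$ (the zero lattice is allowed). Isomorphisms of $\mathcal E^*$-lattices are isometries commuting with the automorphisms $\rho$. Let $U=\langle e,f\rangle$ with $e^2=f^2=0$, $ef=1$, and let $U(3)$ be $U$ with its form multiplied by $3$. Consider $U\oplus U=\langle e_1,f_1\rangle\oplus\langle e_2,f_2\rangle$ and $U\oplus U(3)=\langle e_1,f_1\rangle\oplus\langle e_2',f_2'\rangle$ with the following $\rho$-actions: \[ \text{(1)}\quad e_1\mapsto e_2,\quad e_2\mapsto -e_1-e_2,\quad f_1\mapsto -f_1+f_2,\quad f_2\mapsto -f_1; \] \[ \text{(2)}\quad e_1\mapsto e_1-e_2',\quad e_2'\mapsto 3e_1-2e_2',\quad f_1\mapsto -2f_1-f_2',\quad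 f_2'\mapsto 3f_1+f_2'. \] \textbf{Theorem.} Let $(T,\rho)$ be an $\mathcal E^*$-lattice. By an isotropic plane in $T$ we mean a $\rho$-invariant saturated isotropic sublattice $J\subset T$ of rank $2$. (a) For every isotropic plane $J\subset T$, the quotient $J^\perp/J$, with the induced form and the induced action of $\rho$, is an $\mathcal E^*$-lattice, and there is an orthogonal decomposition $T=H\oplus K$ into $\rho$-invariant sublattices, which are $\mathcal E^*$-lattices, such that $J\subset H$, such that $H$ is isomorphic as an $\mathcal E^*$-lattice to $U\oplus U$ with the action (1) or to $U\oplus U(3)$ with the action (2), and such that $K\subset J^\perp$ and the natural map $K\to J^\perp/J$ is an isomorphism of $\mathcal E^*$-lattices. (b) Let $O_\rho(T)$ be the group of isometries of $T$ commuting with $\rho$. Then $J\mapsto J^\perp/J$ induces a bijection from the set of $O_\rho(T)$-orbits of isotropic planes in $T$ to the set of isomorphism classes of the $\mathcal E^*$-lattices $J^\perp/J$, for $J$ an isotropic plane in $T$. -/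

import Mathlib

universe u v

/-- A finitely generated free `ℤ`-module with a symmetric `ℤ`-valued bilinear form and an
isometry `ρ`.  (Non-degeneracy and the conditions on `ρ` are in `RhoLattice.IsEStar`.) -/
structure RhoLattice where
  carrier : Type u
  [group : AddCommGroup carrier]
  [free : Module.Free ℤ carrier]
  [finite : Module.Finite ℤ carrier]
  form : LinearMap.BilinForm ℤ carrier
  form_symm : ∀ x y, form x y = form y x
  rho : carrier ≃ₗ[ℤ] carrier
  form_rho : ∀ x y, form (rho x) (rho y) = form x y

namespace RhoLattice

instance : CoeSort RhoLattice.{u} (Type u) := ⟨RhoLattice.carrier⟩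

instance (L : RhoLattice.{u}) : AddCommGroup L := L.group

instance (L : RhoLattice.{u}) : Module.Free ℤ L := L.free

instance (L : RhoLattice.{u}) : Module.Finite ℤ L := L.finite

/-- The discriminant group `A_L = L^* / L`, where `L^* = Hom(L, ℤ)` and `L` is mapped to `L^*`
by the bilinear form. -/
abbrev DiscriminantGroup (L : RhoLattice.{u}) : Type u :=
  Module.Dual ℤ L ⧸ LinearMap.range L.form

theorem range_form_le_comap (L : RhoLattice.{u}) :
    LinearMap.range L.form ≤
      (LinearMap.range L.form).comap (L.rho.symm : L →ₗ[ℤ] L).dualMap := by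
  rintro _ ⟨x, rfl⟩
  refine ⟨L.rho x, ?_⟩
  ext y
  have h := L.form_rho x (L.rho.symm y)
  simpa using h

/-- The action of `ρ` on the discriminant group, induced by `φ ↦ φ ∘ ρ⁻¹` on `L^*`
(which restricts to `x ↦ ρ x` on `L`). -/
def discriminantAction (L : RhoLattice.{u}) : L.DiscriminantGroup →ₗ[ℤ] L.DiscriminantGroup :=
  Submodule.mapQ _ _ (L.rho.symm : L →ₗ[ℤ] L).dualMap L.range_form_le_comap

/-- `𝓔^*`-lattices: the form is non-degenerate, `ρ ^ 3 = 1`, `ρ` has no non-zero fixed vector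
(so that `ρ` has order exactly `3` as soon as `L ≠ 0`), and `ρ` acts trivially on the
discriminant group. -/
structure IsEStar (L : RhoLattice.{u}) : Prop where
  nondegenerate : L.form.Nondegenerate
  rho_cubed : ∀ x : L, L.rho (L.rho (L.rho x)) = x
  eq_zero_of_fixed : ∀ x : L, L.rho x = x → x = 0
  trivial_on_discriminant : L.discriminantAction = LinearMap.id

/-- Isomorphisms: isometries commuting with `ρ`. -/
structure Iso (L : RhoLattice.{u}) (M : RhoLattice.{v}) where
  toEquiv : L ≃ₗ[ℤ] M
  map_form : ∀ x y, M.form (toEquiv x) (toEquiv y) = L.form x y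
  map_rho : ∀ x, toEquiv (L.rho x) = M.rho (toEquiv x)

theorem isomorphic_equivalence :
    Equivalence (fun L M : RhoLattice.{u} => Nonempty (Iso L M)) where
  refl L := ⟨⟨LinearEquiv.refl ℤ L, fun _ _ => rfl, fun _ => rfl⟩⟩
  symm := by
    rintro L M ⟨f⟩
    refine ⟨⟨f.toEquiv.symm, fun x y => ?_, fun x => ?_⟩⟩
    · simpa using (f.map_form (f.toEquiv.symm x) (f.toEquiv.symm y)).symm
    · apply f.toEquiv.injective
      simp [f.map_rho]
  trans := by
    rintro L M N ⟨f⟩ ⟨g⟩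
    exact ⟨⟨f.toEquiv.trans g.toEquiv, fun x y => by simp [f.map_form, g.map_form],
      fun x => by simp [f.map_rho, g.map_rho]⟩⟩

/-- Being isomorphic, as a setoid. -/
def isoSetoid : Setoid RhoLattice.{u} :=
  ⟨fun L M => Nonempty (Iso L M), isomorphic_equivalence⟩

/-- Isomorphism classes. -/
def IsoClass : Type (u + 1) := Quotient isoSetoid.{u}

/-- The isomorphism class of `L`. -/
def isoClass (L : RhoLattice.{u}) : IsoClass.{u} := Quotient.mk isoSetoid L

/-- A `ρ`-invariant submodule, with the restricted form and the restricted isometry. -/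
def sub (L : RhoLattice.{u}) (P : Submodule ℤ L) (hP : P.map (L.rho : L →ₗ[ℤ] L) = P) :
    RhoLattice.{u} where
  carrier := P
  form := L.form.restrict P
  form_symm x y := L.form_symm x y
  rho := L.rho.ofSubmodules P P hP
  form_rho x y := L.form_rho x y

/-- `L` is the orthogonal direct sum of its submodules `P` and `Q`. -/
def IsOrthogonalSum (L : RhoLattice.{u}) (P Q : Submodule ℤ L) : Prop :=
  IsCompl P Q ∧ ∀ x ∈ P, ∀ y ∈ Q, L.form x y = 0

/-- The `ρ`-invariant isotropic planes of `L`: isotropic, saturated, `ρ`-invariant submodules of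
rank `2`. -/
structure IsotropicPlane (L : RhoLattice.{u}) where
  toSubmodule : Submodule ℤ L
  rank_eq_two : Module.finrank ℤ toSubmodule = 2
  isotropic : ∀ x ∈ toSubmodule, ∀ y ∈ toSubmodule, L.form x y = 0
  saturated : ∀ (n : ℤ) (x : L), n ≠ 0 → n • x ∈ toSubmodule → x ∈ toSubmodule
  invariant : toSubmodule.map (L.rho : L →ₗ[ℤ] L) = toSubmodule

/-- The group `O_ρ(L)` of isometries of `L` commuting with `ρ`. -/
def isometryGroup (L : RhoLattice.{u}) : Subgroup (L ≃ₗ[ℤ] L) where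
  carrier := {g | (∀ x y, L.form (g x) (g y) = L.form x y) ∧ ∀ x, g (L.rho x) = L.rho (g x)}
  one_mem' := ⟨fun _ _ => rfl, fun _ => rfl⟩
  mul_mem' := by
    rintro g h ⟨hg, hg'⟩ ⟨hh, hh'⟩
    exact ⟨fun x y => by simp [hg, hh], fun x => by simp [hg', hh']⟩
  inv_mem' := by
    rintro g ⟨hg, hg'⟩
    refine ⟨fun x y => ?_, fun x => ?_⟩
    · have h := hg (g.symm x) (g.symm y)
      simpa using h.symm
    · apply g.injective
      have h := hg' (g.symm x)
      simp only [LinearEquiv.apply_symm_apply] at h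
      change g (g.symm (L.rho x)) = g (L.rho (g.symm x))
      rw [h, LinearEquiv.apply_symm_apply]

namespace IsotropicPlane

variable {L : RhoLattice.{u}}

theorem ext' {J K : L.IsotropicPlane} (h : J.toSubmodule = K.toSubmodule) : J = K := by
  cases J; cases K; cases h; rfl

/-- The image `g J` of a plane under an isometry `g` commuting with `ρ`. -/
def image (g : L.isometryGroup) (J : L.IsotropicPlane) : L.IsotropicPlane where
  toSubmodule := J.toSubmodule.map ((g : L ≃ₗ[ℤ] L) : L →ₗ[ℤ] L)
  rank_eq_two := by
    rw [← J.rank_eq_two]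
    exact ((g : L ≃ₗ[ℤ] L).submoduleMap J.toSubmodule).finrank_eq.symm
  isotropic := by
    rintro _ ⟨x, hx, rfl⟩ _ ⟨y, hy, rfl⟩
    exact (g.2.1 x y).trans (J.isotropic x hx y hy)
  saturated := by
    rintro n x hn ⟨y, hy, hxy⟩
    refine ⟨(g : L ≃ₗ[ℤ] L).symm x, J.saturated n _ hn ?_, by simp⟩
    have h : (g : L ≃ₗ[ℤ] L) y = n • x := hxy
    rw [← map_smul, ← h, LinearEquiv.symm_apply_apply]
    exact hy
  invariant := by
    conv_rhs => rw [← J.invariant]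
    rw [← Submodule.map_comp, ← Submodule.map_comp]
    congr 1
    ext x
    exact (g.2.2 x).symm

instance : MulAction L.isometryGroup L.IsotropicPlane where
  smul := image
  one_smul J := ext' (Submodule.map_id J.toSubmodule)
  mul_smul g h J := ext' (Submodule.map_comp
    ((h : L ≃ₗ[ℤ] L) : L →ₗ[ℤ] L) ((g : L ≃ₗ[ℤ] L) : L →ₗ[ℤ] L) J.toSubmodule)

/-- The orthogonal complement `J^⊥` in `L`. -/
def perp (J : L.IsotropicPlane) : Submodule ℤ L := L.form.orthogonal J.toSubmodule

theorem mem_perp (J : L.IsotropicPlane) {x : L} :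
    x ∈ J.perp ↔ ∀ y ∈ J.toSubmodule, L.form y x = 0 := Iff.rfl

theorem perp_invariant (J : L.IsotropicPlane) :
    J.perp.map (L.rho : L →ₗ[ℤ] L) = J.perp := by
  apply le_antisymm
  · rintro _ ⟨x, hx, rfl⟩ y hy
    rw [← J.invariant] at hy
    obtain ⟨z, hz, rfl⟩ := hy
    exact (L.form_rho z x).trans (hx z hz)
  · intro x hx
    refine ⟨L.rho.symm x, fun y hy => ?_, by simp⟩
    have h1 : L.rho y ∈ J.toSubmodule := by
      rw [← J.invariant]; exact ⟨y, hy, rfl⟩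
    have h2 := L.form_rho y (L.rho.symm x)
    rw [LinearEquiv.apply_symm_apply] at h2
    exact h2.symm.trans (hx _ h1)

/-- `J` as a submodule of `J^⊥`. -/
abbrev inPerp (J : L.IsotropicPlane) : Submodule ℤ J.perp := J.toSubmodule.submoduleOf J.perp

theorem form_left_eq_zero (J : L.IsotropicPlane) (x y : J.perp) (hx : x ∈ J.inPerp) :
    L.form x y = 0 := y.2 x hx

/-- The bilinear form on `J^⊥ / J` induced by the form of `L`. -/
def quotForm (J : L.IsotropicPlane) : LinearMap.BilinForm ℤ (J.perp ⧸ J.inPerp) :=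
  J.inPerp.liftQ
    (LinearMap.flip (J.inPerp.liftQ (LinearMap.flip (L.form.restrict J.perp)) (by
      intro y hy
      ext x
      exact (L.form_symm x y).trans (J.form_left_eq_zero y x hy))))
    (by
      intro x hx
      ext y
      exact J.form_left_eq_zero x y hx)

theorem quotForm_mk (J : L.IsotropicPlane) (x y : J.perp) :
    J.quotForm (Submodule.Quotient.mk x) (Submodule.Quotient.mk y) = L.form x y := rfl

theorem inPerp_invariant (J : L.IsotropicPlane) :
    J.inPerp.map (L.rho.ofSubmodules J.perp J.perp J.perp_invariant : J.perp →ₗ[ℤ] J.perp)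
      = J.inPerp := by
  apply le_antisymm
  · rintro _ ⟨x, hx, rfl⟩
    change L.rho x ∈ J.toSubmodule
    rw [← J.invariant]
    exact ⟨x, hx, rfl⟩
  · intro x hx
    have hx' : (x : L) ∈ J.toSubmodule := hx
    rw [← J.invariant] at hx'
    obtain ⟨z, hz, hzx⟩ := hx'
    exact ⟨⟨z, fun w hw => J.isotropic w hw z hz⟩, hz, Subtype.ext hzx⟩

instance (J : L.IsotropicPlane) : Module.Free ℤ (J.perp ⧸ J.inPerp) := by
  have : Module.IsTorsionFree ℤ (J.perp ⧸ J.inPerp) := by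
    rw [Module.isTorsionFree_iff_smul_eq_zero]
    intro n q hq
    induction q using Submodule.Quotient.induction_on with
    | H x =>
      by_cases hn : n = 0
      · exact Or.inl hn
      · right
        rw [← Submodule.Quotient.mk_smul, Submodule.Quotient.mk_eq_zero] at hq
        rw [Submodule.Quotient.mk_eq_zero]
        exact J.saturated n x hn hq
  infer_instance

/-- The lattice `J^⊥ / J` with the induced form and the induced isometry. -/
def perpQuotient (J : L.IsotropicPlane) : RhoLattice.{u} where
  carrier := J.perp ⧸ J.inPerp
  form := J.quotForm
  form_symm p q := by
    induction p using Submodule.Quotient.induction_on with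
    | H x =>
      induction q using Submodule.Quotient.induction_on with
      | H y => exact L.form_symm x y
  rho := Submodule.Quotient.equiv J.inPerp J.inPerp
    (L.rho.ofSubmodules J.perp J.perp J.perp_invariant) J.inPerp_invariant
  form_rho p q := by
    induction p using Submodule.Quotient.induction_on with
    | H x =>
      induction q using Submodule.Quotient.induction_on with
      | H y => exact L.form_rho x y

/-- The natural map `K → J^⊥ / J` for a submodule `K` of `J^⊥`. -/
def toPerpQuotient (J : L.IsotropicPlane) (K : Submodule ℤ L) (hK : K ≤ J.perp) :
    K →ₗ[ℤ] J.perpQuotient :=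
  J.inPerp.mkQ ∘ₗ Submodule.inclusion hK

end IsotropicPlane

/-- The lattice `ℤ ^ 4` with Gram matrix `G` and with the isometry of order dividing `3` given by
the matrix `R` (the columns of `R` are the images of the basis vectors). -/
def ofMatrix (G R : Matrix (Fin 4) (Fin 4) ℤ) (hG : G.transpose = G) (hR : R * (R * R) = 1)
    (hGR : R.transpose * G * R = G) : RhoLattice.{0} where
  carrier := Fin 4 → ℤ
  form := Matrix.toBilin' G
  form_symm x y := by
    rw [Matrix.toBilin'_apply', Matrix.toBilin'_apply', Matrix.dotProduct_mulVec, dotProduct_comm,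
      ← Matrix.mulVec_transpose, hG]
  rho := LinearEquiv.ofLinearMap (Matrix.toLin' R) (Matrix.toLin' (R * R))
    (by rw [← Matrix.toLin'_mul, hR, Matrix.toLin'_one])
    (by rw [← Matrix.toLin'_mul, Matrix.mul_assoc, hR, Matrix.toLin'_one])
  form_rho x y := by
    change Matrix.toBilin' G (Matrix.toLin' R x) (Matrix.toLin' R y) = Matrix.toBilin' G x y
    conv_rhs => rw [← hGR]
    rw [← Matrix.toBilin'_comp]
    rfl

/-- The Gram matrix of `U ⊕ U(m)` in the basis `e₁, f₁, e₂, f₂`: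
`e₁ f₁ = 1`, `e₂ f₂ = m`, and all other products are zero. -/
def gramUU (m : ℤ) : Matrix (Fin 4) (Fin 4) ℤ :=
  !![0, 1, 0, 0;
     1, 0, 0, 0;
     0, 0, 0, m;
     0, 0, m, 0]

/-- `U ⊕ U` with basis `e₁, f₁, e₂, f₂` and
`ρ : e₁ ↦ e₂, f₁ ↦ -f₁ + f₂, e₂ ↦ -e₁ - e₂, f₂ ↦ -f₁`. -/
def latticeUU : RhoLattice.{0} :=
  ofMatrix (gramUU 1)
    !![0,  0, -1,  0;
       0, -1,  0, -1;
       1,  0, -1,  0;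
       0,  1,  0,  0]
    (by decide) (by decide) (by decide)

/-- `U ⊕ U(3)` with basis `e₁, f₁, e₂', f₂'` and
`ρ : e₁ ↦ e₁ - e₂', f₁ ↦ -2 f₁ - f₂', e₂' ↦ 3 e₁ - 2 e₂', f₂' ↦ 3 f₁ + f₂'`. -/
def latticeUU3 : RhoLattice.{0} :=
  ofMatrix (gramUU 3)
    !![ 1,  0,  3,  0;
        0, -2,  0,  3;
       -1,  0, -2,  0;
        0, -1,  0,  1]
    (by decide) (by decide) (by decide)

end RhoLattice

/-!
The relation `1 + ρ + ρ ^ 2 = 0` makes an `𝓔^*`-lattice `T` a module over the Eisenstein integers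
`ℤ[ω]`, a principal ideal domain, with `ω` acting as `ρ`. The bilinear form is the `ω`-coordinate
of a skew-hermitian form `h` (`RhoLattice.hermitian`). Put `η = 1 - ω ^ 2`, a generator of the
prime above `3`. That `ρ` acts trivially on the discriminant group means that `η` times any
linear functional on `T` is represented by a vector of `T`
(`RhoLattice.exists_hermitian_eq_η_mul`).

An isotropic plane `J` is `ℤ[ω] e` for some `e`, and since `J` is saturated some functional takes
the value `1` at `e`; so some `z` has `h e z = η` and `h x z ∈ (η)` for all `x`. If `h e` has all
its values in `(η)`, put `ε = η` and start from `z`; otherwise `1` is a value of `h e`, since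
`(η)` is maximal, and `ε = 1`. Moving along `e` produces an isotropic `f` with `h e f = ε` such
that `ε` divides `h e x` and `h x f` for all `x` (`exists_hyperbolicPair`). This divisibility
splits off the span `H` of `e` and `f`, which is `U ⊕ U` for `ε = 1` and `U ⊕ U(3)` for `ε = η`;
the complement `K` of `H` maps isomorphically to `J^⊥ / J`.

For planes `J`, `J'` with isomorphic quotients the complements `K`, `K'` are isomorphic, and then
`ε = ε'`, because otherwise the discriminants of `H ⊕ K` and `H' ⊕ K'` would differ by the factor
`9` (`HyperbolicPair.false_of_iso`). So `e ↦ e'`, `f ↦ f'` and `K ≅ K'` glue to an isometry of `T`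
that commutes with `ρ` and takes `J` to `J'` (`HyperbolicPair.glue`).
-/

/-! ### Eisenstein integers -/

/-- The ring `ℤ[ω]` of Eisenstein integers, `ω ^ 2 = -1 - ω`. -/
abbrev Eisenstein : Type := QuadraticAlgebra ℤ (-1) (-1)

namespace Eisenstein

/-- The primitive cube root of unity `ω`. -/
def ω : Eisenstein := ⟨0, 1⟩

/-- The element `2 + ω = 1 - ω ^ 2`, a generator of the prime ideal above `3`. -/
def η : Eisenstein := ⟨2, 1⟩

@[simp] theorem ω_re : ω.re = 0 := rfl

@[simp] theorem ω_im : ω.im = 1 := rfl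

@[simp] theorem η_re : η.re = 2 := rfl

@[simp] theorem η_im : η.im = 1 := rfl

theorem η_ne_zero : η ≠ 0 := fun h => by simpa using congrArg QuadraticAlgebra.im h

theorem norm_eq (z : Eisenstein) : z.norm = z.re * z.re - z.re * z.im + z.im * z.im := by
  rw [QuadraticAlgebra.norm_def]; ring

theorem norm_nonneg (z : Eisenstein) : 0 ≤ z.norm := by
  rw [norm_eq]; nlinarith [sq_nonneg (2 * z.re - z.im), sq_nonneg z.im]

theorem norm_eq_zero_iff {z : Eisenstein} : z.norm = 0 ↔ z = 0 := by
  refine ⟨fun h => ?_, fun h => by simp [h]⟩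
  rw [norm_eq] at h
  have him : z.im = 0 := by
    rw [← sq_eq_zero_iff]; nlinarith [sq_nonneg (2 * z.re - z.im), sq_nonneg z.im]
  have hre : z.re = 0 := by simpa [him] using h
  exact QuadraticAlgebra.ext hre him

theorem norm_pos {z : Eisenstein} (hz : z ≠ 0) : 0 < z.norm :=
  lt_of_le_of_ne (norm_nonneg z) fun h => hz (norm_eq_zero_iff.1 h.symm)

theorem star_mul_self (z : Eisenstein) : star z * z = (z.norm : Eisenstein) := by
  rw [mul_comm, ← QuadraticAlgebra.algebraMap_norm_eq_mul_star]
  rfl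

instance : IsDomain Eisenstein :=
  have : NoZeroDivisors Eisenstein :=
    ⟨fun {a b} h => by
      rw [← norm_eq_zero_iff, map_mul, mul_eq_zero] at h
      simpa only [norm_eq_zero_iff] using h⟩
  NoZeroDivisors.to_isDomain _

theorem exists_two_mul_abs_sub_le (x : ℤ) {n : ℤ} (hn : 0 < n) :
    ∃ q : ℤ, |2 * (x - n * q)| ≤ n := by
  refine ⟨(2 * x + n) / (2 * n), ?_⟩
  have h1 := Int.emod_add_mul_ediv (2 * x + n) (2 * n)
  have h2 := Int.emod_nonneg (2 * x + n) (by omega : 2 * n ≠ 0)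
  have h3 := Int.emod_lt_of_pos (2 * x + n) (by omega : 0 < 2 * n)
  rw [abs_le]
  constructor <;> linarith

/-- Division with remainder: the quotient is `a / b` with its two coordinates rounded. -/
theorem exists_norm_sub_mul_lt (a : Eisenstein) {b : Eisenstein} (hb : b ≠ 0) :
    ∃ q : Eisenstein, (a - q * b).norm < b.norm := by
  have hn := norm_pos hb
  obtain ⟨p, hp⟩ := exists_two_mul_abs_sub_le (a * star b).re hn
  obtain ⟨q, hq⟩ := exists_two_mul_abs_sub_le (a * star b).im hn
  refine ⟨⟨p, q⟩, ?_⟩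
  -- compare after multiplication by `star b`, where `q * b` becomes `norm b • q`
  have h1 : (a - ⟨p, q⟩ * b) * star b
      = ⟨(a * star b).re - b.norm * p, (a * star b).im - b.norm * q⟩ := by
    rw [sub_mul, mul_assoc, mul_comm b, star_mul_self]
    ext <;> simp <;> ring
  have h2 := congrArg QuadraticAlgebra.norm h1
  rw [map_mul, QuadraticAlgebra.norm_star] at h2
  set x := (a * star b).re - b.norm * p
  set y := (a * star b).im - b.norm * q
  have h3 : QuadraticAlgebra.norm (⟨x, y⟩ : Eisenstein) = x * x - x * y + y * y := norm_eq _
  rw [h3] at h2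
  rw [abs_le] at hp hq
  by_contra hlt
  rw [not_lt] at hlt
  have hx := mul_nonneg (sub_nonneg.2 hp.1) (sub_nonneg.2 hp.2)
  have hy := mul_nonneg (sub_nonneg.2 hq.1) (sub_nonneg.2 hq.2)
  have hm := mul_le_mul_of_nonneg_right hlt hn.le
  have hpos := mul_pos hn hn
  linarith [sq_nonneg (x + y)]

instance : IsPrincipalIdealRing Eisenstein := by
  refine ⟨fun I => ?_⟩
  by_cases hI : I = ⊥
  · subst hI; infer_instance
  obtain ⟨x, hx, hx0⟩ := Submodule.exists_mem_ne_zero_of_ne_bot hI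
  -- a nonzero element of least norm generates the ideal
  obtain ⟨b, ⟨hbI, hb0⟩, hmin⟩ := WellFounded.has_min
    (measure fun z : Eisenstein => z.norm.toNat).wf {z | z ∈ I ∧ z ≠ 0} ⟨x, hx, hx0⟩
  refine ⟨⟨b, le_antisymm (fun a ha => ?_) (by simpa [Submodule.span_le] using hbI)⟩⟩
  obtain ⟨q, hq⟩ := exists_norm_sub_mul_lt a hb0
  have hr : a - q * b = 0 := by
    by_contra hr
    refine hmin _ ⟨I.sub_mem ha (I.mul_mem_left q hbI), hr⟩ ?_
    change (a - q * b).norm.toNat < b.norm.toNat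
    have := norm_nonneg (a - q * b)
    omega
  exact Submodule.mem_span_singleton.2 ⟨q, (sub_eq_zero.1 hr).symm⟩

/-- `ω ≡ 1` modulo `η`, and `η` has norm `3`. -/
theorem η_dvd_iff (z : Eisenstein) : η ∣ z ↔ (3 : ℤ) ∣ z.re + z.im := by
  constructor
  · rintro ⟨w, rfl⟩
    exact ⟨w.re, by simp; ring⟩
  · rintro ⟨k, hk⟩
    refine ⟨⟨k, z.im - k⟩, ?_⟩
    ext <;> simp <;> linarith

theorem η_dvd_star {z : Eisenstein} (h : η ∣ z) : η ∣ star z := by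
  rw [η_dvd_iff] at h ⊢
  simp only [QuadraticAlgebra.re_star, QuadraticAlgebra.im_star]
  omega

theorem η_dvd_sub_one_or_add_one {z : Eisenstein} (h : ¬ η ∣ z) : η ∣ z - 1 ∨ η ∣ z + 1 := by
  rw [η_dvd_iff] at h ⊢
  rw [η_dvd_iff]
  simp only [QuadraticAlgebra.re_sub, QuadraticAlgebra.im_sub, QuadraticAlgebra.re_add,
    QuadraticAlgebra.im_add, QuadraticAlgebra.re_one, QuadraticAlgebra.im_one]
  omega

theorem not_isUnit_star_η : ¬ IsUnit (star η) := by
  rw [isUnit_star, isUnit_iff_dvd_one, η_dvd_iff]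
  norm_num [QuadraticAlgebra.re_one, QuadraticAlgebra.im_one]

theorem sub_star_eq (z : Eisenstein) : z - star z = ⟨z.im, 2 * z.im⟩ := by
  ext <;> simp; ring

/-- Skew elements are integral multiples of `ω - ω ^ 2 = 1 + 2 ω`. -/
theorem eq_of_eq_neg_star {z : Eisenstein} (h : z = -star z) : ∃ n : ℤ, z = ⟨n, 2 * n⟩ := by
  refine ⟨z.re, ?_⟩
  have h1 := congrArg QuadraticAlgebra.re h
  ext
  · rfl
  · simp at h1 ⊢; linarith

end Eisenstein

/-! ### Skew-hermitian modules and hyperbolic pairs -/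

section SkewHermitian

open Eisenstein

variable {M : Type*} [AddCommGroup M] [Module Eisenstein M]
  (h : M →ₗ[Eisenstein] M →ₛₗ[starRingEnd Eisenstein] Eisenstein)

/-- Two isotropic vectors `e`, `f` with `h e f = ε` such that all values `h e x` and `h x f` are
divisible by `ε`.  The divisibility makes the span of `e` and `f` an orthogonal summand. -/
structure HyperbolicPair (e f : M) (ε : Eisenstein) : Prop where
  left_isotropic : h e e = 0
  right_isotropic : h f f = 0
  pairing : h e f = ε
  dvd_left : ∀ x, ε ∣ h e x
  dvd_right : ∀ x, ε ∣ h x f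

section Existence

variable {h}

/-- If `e` is isotropic and `c * h e f` has `ω`-coordinate `1` for some `c`, then `f` can be moved
along `e` to an isotropic vector: `h f f` is skew, so it is an integral multiple of
`ω - ω ^ 2 = c * h e f - star (c * h e f)`, by which `h f f` changes under `f ↦ f + c • e`. -/
theorem exists_add_smul_isotropic (skew : ∀ x y, h x y = -star (h y x)) {e f : M}
    (he : h e e = 0) (c : Eisenstein) (hc : (c * h e f).im = 1) :
    ∃ a : Eisenstein, h (f + a • e) (f + a • e) = 0 := by
  obtain ⟨n, hn⟩ := eq_of_eq_neg_star (skew f f)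
  refine ⟨-(n : Eisenstein) * c, ?_⟩
  have key : h (f + (-(n : Eisenstein) * c) • e) (f + (-(n : Eisenstein) * c) • e)
      = h f f - n * (c * h e f - star (c * h e f)) := by
    simp only [map_add, LinearMap.add_apply, map_smul, LinearMap.smul_apply, map_smulₛₗ,
      smul_eq_mul, he, starRingEnd_apply]
    rw [skew f e]
    simp only [star_mul, star_neg, star_intCast]
    ring
  rw [key, sub_star_eq, hc, hn]
  ext <;> simp; ring

/-- An isotropic vector `e` on which some functional `lam` takes the value `1` is half of a
hyperbolic pair, as soon as `η • lam` is represented by a vector `z`.  If `η` divides all `h e x`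
then `f` is found near `z`; otherwise `1` is a value of `h e`, because `h e z = η` and the ideal
`(η)` is maximal. -/
theorem exists_hyperbolicPair (skew : ∀ x y, h x y = -star (h y x)) {e : M} (he : h e e = 0)
    (lam : M →ₗ[Eisenstein] Eisenstein) (hlam : lam e = 1) (z : M)
    (hz : ∀ x, h x z = η * lam x) :
    ∃ f ε, (ε = 1 ∨ ε = η) ∧ HyperbolicPair h e f ε := by
  have hez : h e z = η := by rw [hz, hlam, mul_one]
  by_cases hdvd : ∀ x, η ∣ h e x
  · obtain ⟨a, ha⟩ := exists_add_smul_isotropic skew he (f := z) 1 (by rw [hez, one_mul, η_im])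
    refine ⟨z + a • e, η, Or.inr rfl, he, ha, ?_, hdvd, fun x => ?_⟩
    · simp [he, hez]
    · rw [map_add, hz, map_smulₛₗ, skew x e]
      exact dvd_add (dvd_mul_right _ _) (((η_dvd_star (hdvd x)).neg_right).mul_left _)
  · push Not at hdvd
    obtain ⟨x, hx⟩ := hdvd
    have hf : ∃ f, h e f = 1 := by
      rcases η_dvd_sub_one_or_add_one hx with ⟨t, ht⟩ | ⟨t, ht⟩
      · refine ⟨x - star t • z, ?_⟩
        rw [map_sub, map_smulₛₗ, hez, starRingEnd_apply, star_star, smul_eq_mul]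
        linear_combination ht
      · refine ⟨star t • z - x, ?_⟩
        rw [map_sub, map_smulₛₗ, hez, starRingEnd_apply, star_star, smul_eq_mul]
        linear_combination -ht
    obtain ⟨f, hf⟩ := hf
    obtain ⟨a, ha⟩ := exists_add_smul_isotropic skew he (f := f) ω (by rw [hf, mul_one, ω_im])
    exact ⟨f + a • e, 1, Or.inl rfl, he, ha, by simp [he, hf], fun x => one_dvd _,
      fun x => one_dvd _⟩

end Existence

namespace HyperbolicPair

variable {h} {e f : M} {ε : Eisenstein}

/-- The common orthogonal complement of `e` and `f`. -/
def complement (h : M →ₗ[Eisenstein] M →ₛₗ[starRingEnd Eisenstein] Eisenstein) (e f : M) :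
    Submodule Eisenstein M :=
  LinearMap.ker (h.flip e) ⊓ LinearMap.ker (h.flip f)

theorem mem_complement {x : M} : x ∈ complement h e f ↔ h x e = 0 ∧ h x f = 0 := Iff.rfl

/-- The map `(a, b, k) ↦ a e + b f + k`. -/
def coordMap (h : M →ₗ[Eisenstein] M →ₛₗ[starRingEnd Eisenstein] Eisenstein) (e f : M) :
    (Eisenstein × Eisenstein × complement h e f) →ₗ[Eisenstein] M :=
  (LinearMap.toSpanSingleton Eisenstein M e).coprod
    ((LinearMap.toSpanSingleton Eisenstein M f).coprod (complement h e f).subtype)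

theorem coordMap_apply (p : Eisenstein × Eisenstein × complement h e f) :
    coordMap h e f p = p.1 • e + (p.2.1 • f + (p.2.2 : M)) := rfl

/-- In coordinates, `h` is the hyperbolic form scaled by `ε` plus its restriction to the
complement. -/
theorem apply_coordMap (skew : ∀ x y, h x y = -star (h y x)) (H : HyperbolicPair h e f ε)
    (p q : Eisenstein × Eisenstein × complement h e f) :
    h (coordMap h e f p) (coordMap h e f q)
      = p.1 * star q.2.1 * ε - p.2.1 * star q.1 * star ε + h p.2.2 q.2.2 := by
  obtain ⟨a, b, k, hk⟩ := p
  obtain ⟨a', b', k', hk'⟩ := q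
  rw [mem_complement] at hk hk'
  simp only [coordMap_apply, map_add, LinearMap.add_apply, map_smul, LinearMap.smul_apply,
    map_smulₛₗ, smul_eq_mul, starRingEnd_apply, H.left_isotropic, H.right_isotropic, H.pairing,
    skew f e, skew e k', skew f k', hk.1, hk.2, hk'.1, hk'.2, star_zero]
  ring

theorem coordMap_bijective (skew : ∀ x y, h x y = -star (h y x)) (H : HyperbolicPair h e f ε)
    (hε : ε ≠ 0) : Function.Bijective (coordMap h e f) := by
  have hef : h f e = -star ε := by rw [skew, H.pairing]
  constructor
  · rw [← LinearMap.ker_eq_bot, LinearMap.ker_eq_bot']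
    rintro ⟨a, b, k, hk⟩ h0
    rw [coordMap_apply] at h0
    dsimp only at h0
    have hk' := hk
    rw [mem_complement] at hk'
    have h1 : a * ε = 0 := by
      have := congrArg (fun x => h x f) h0
      simpa [H.right_isotropic, H.pairing, hk'.2] using this
    have h2 : b * star ε = 0 := by
      have := congrArg (fun x => h x e) h0
      simpa [H.left_isotropic, hef, hk'.1] using this
    have ha : a = 0 := (mul_eq_zero.1 h1).resolve_right hε
    have hb : b = 0 := (mul_eq_zero.1 h2).resolve_right (star_ne_zero.2 hε)
    subst ha hb
    have hk0 : k = 0 := by simpa using h0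
    subst hk0
    rfl
  · intro x
    obtain ⟨a, ha⟩ := H.dvd_right x
    obtain ⟨b, hb⟩ := H.dvd_left x
    have hb' : h x e = -(star b * star ε) := by rw [skew, hb, star_mul]
    refine ⟨(a, star b, ⟨x - (a • e + star b • f), ?_⟩), ?_⟩
    · rw [mem_complement]
      constructor
      · simp [H.left_isotropic, hef, hb']
      · simp [H.right_isotropic, H.pairing, ha, mul_comm]
    · rw [coordMap_apply]
      dsimp only
      abel

/-- The decomposition of `M` into the hyperbolic plane spanned by `e`, `f` and its complement. -/
noncomputable def coordEquiv (skew : ∀ x y, h x y = -star (h y x)) (H : HyperbolicPair h e f ε)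
    (hε : ε ≠ 0) : (Eisenstein × Eisenstein × complement h e f) ≃ₗ[Eisenstein] M :=
  LinearEquiv.ofBijective (coordMap h e f) (H.coordMap_bijective skew hε)

section Glue

variable {e' f' : M} {ε' : Eisenstein}

/-- The automorphism `a e + b f + k ↦ a e' + b f' + ψ k` given by two hyperbolic pairs and an
isomorphism `ψ` of their complements. -/
noncomputable def glue (skew : ∀ x y, h x y = -star (h y x)) (H : HyperbolicPair h e f ε)
    (H' : HyperbolicPair h e' f' ε') (hε : ε ≠ 0) (hε' : ε' ≠ 0)
    (ψ : complement h e f ≃ₗ[Eisenstein] complement h e' f') : M ≃ₗ[Eisenstein] M :=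
  (H.coordEquiv skew hε).symm.trans
    (((LinearEquiv.refl _ Eisenstein).prodCongr ((LinearEquiv.refl _ Eisenstein).prodCongr ψ)).trans
      (H'.coordEquiv skew hε'))

variable (skew : ∀ x y, h x y = -star (h y x)) (H : HyperbolicPair h e f ε)
    (H' : HyperbolicPair h e' f' ε') (hε : ε ≠ 0) (hε' : ε' ≠ 0)
    {ψ : complement h e f ≃ₗ[Eisenstein] complement h e' f'}

theorem glue_coordMap (p : Eisenstein × Eisenstein × complement h e f) :
    glue skew H H' hε hε' ψ (coordMap h e f p) = coordMap h e' f' (p.1, p.2.1, ψ p.2.2) := by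
  have h1 : (H.coordEquiv skew hε).symm (coordMap h e f p) = p :=
    (H.coordEquiv skew hε).symm_apply_apply p
  rw [glue, LinearEquiv.trans_apply, h1]
  rfl

theorem apply_glue (hψ : ∀ k l, h (ψ k) (ψ l) = h k l)
    (p q : Eisenstein × Eisenstein × complement h e f) :
    h (glue skew H H' hε hε' ψ (coordMap h e f p)) (glue skew H H' hε hε' ψ (coordMap h e f q))
      = p.1 * star q.2.1 * ε' - p.2.1 * star q.1 * star ε' + h p.2.2 q.2.2 := by
  rw [glue_coordMap, glue_coordMap, H'.apply_coordMap skew, hψ]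

end Glue

end HyperbolicPair

end SkewHermitian

/-! ### `𝓔^*`-lattices as modules over the Eisenstein integers -/

namespace RhoLattice
open Eisenstein

variable {L : RhoLattice.{u}}

theorem IsEStar.sum_orbit_eq_zero (hL : L.IsEStar) (x : L) : x + L.rho x + L.rho (L.rho x) = 0 :=
  hL.eq_zero_of_fixed _ (by rw [map_add, map_add, hL.rho_cubed]; abel)

theorem IsEStar.rho_rho (hL : L.IsEStar) (x : L) : L.rho (L.rho x) = -x - L.rho x := by
  rw [← sub_eq_zero, ← hL.sum_orbit_eq_zero x]
  abel

theorem IsEStar.rho_symm (hL : L.IsEStar) (x : L) : L.rho.symm x = -x - L.rho x := by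
  rw [LinearEquiv.symm_apply_eq, map_sub, map_neg, hL.rho_rho]
  abel

/-- Triviality of the action on the discriminant group, spelled out on functionals. -/
theorem discriminantAction_eq_id_iff :
    L.discriminantAction = LinearMap.id ↔
      ∀ φ : Module.Dual ℤ L, ∃ z : L, ∀ x, L.form z x = φ (L.rho.symm x) - φ x := by
  have key : ∀ φ : Module.Dual ℤ L,
      L.discriminantAction (Submodule.Quotient.mk φ) = Submodule.Quotient.mk φ ↔
        ∃ z : L, ∀ x, L.form z x = φ (L.rho.symm x) - φ x := by
    intro φ
    change Submodule.Quotient.mk ((L.rho.symm : L →ₗ[ℤ] L).dualMap φ) = _ ↔ _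
    rw [Submodule.Quotient.eq]
    exact exists_congr fun z => LinearMap.ext_iff
  refine ⟨fun h φ => (key φ).1 (by rw [h]; rfl), fun h => LinearMap.ext fun q => ?_⟩
  induction q using Submodule.Quotient.induction_on with
  | H φ => exact (key φ).2 (h φ)

/-- An `𝓔^*`-lattice as a module over the Eisenstein integers, with `ω` acting as `ρ`. -/
instance eisensteinModule [hL : Fact L.IsEStar] : Module Eisenstein L where
  smul c x := c.re • x + c.im • L.rho x
  one_smul x := by
    change (1 : ℤ) • x + (0 : ℤ) • L.rho x = x
    simp
  mul_smul c d x := by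
    change (c * d).re • x + (c * d).im • L.rho x = c.re • (d.re • x + d.im • L.rho x)
      + c.im • L.rho (d.re • x + d.im • L.rho x)
    simp only [map_add, map_zsmul, hL.out.rho_rho, QuadraticAlgebra.re_mul,
      QuadraticAlgebra.im_mul]
    module
  smul_zero c := by
    change c.re • (0 : L) + c.im • L.rho 0 = 0
    simp
  smul_add c x y := by
    change c.re • (x + y) + c.im • L.rho (x + y) = (c.re • x + c.im • L.rho x)
      + (c.re • y + c.im • L.rho y)
    rw [map_add]; module
  add_smul c d x := by
    change (c.re + d.re) • x + (c.im + d.im) • L.rho x = (c.re • x + c.im • L.rho x)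
      + (d.re • x + d.im • L.rho x)
    module
  zero_smul x := by
    change (0 : ℤ) • x + (0 : ℤ) • L.rho x = 0
    simp

section

variable [hL : Fact L.IsEStar]

theorem smul_def (c : Eisenstein) (x : L) : c • x = c.re • x + c.im • L.rho x := rfl

theorem ω_smul (x : L) : ω • x = L.rho x := by simp [smul_def]

theorem form_rho_right (x y : L) : L.form x (L.rho y) = -L.form x y - L.form (L.rho x) y := by
  have h1 := L.form_rho x (L.rho y)
  have h2 := L.form_rho x y
  rw [hL.out.rho_rho, map_sub, map_neg] at h1
  linarith

variable (L) in
/-- The skew-hermitian form over the Eisenstein integers whose `ω`-coordinate is the bilinear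
form of the lattice. -/
def hermitian : L →ₗ[Eisenstein] L →ₛₗ[starRingEnd Eisenstein] Eisenstein :=
  LinearMap.mk₂'ₛₗ (RingHom.id Eisenstein) (starRingEnd Eisenstein)
    (fun x y => ⟨-L.form x (L.rho y), L.form x y⟩)
    (fun x x' y => by ext <;> simp; ring)
    (fun c x y => by
      rw [smul_def]
      ext <;> simp [form_rho_right, hL.out.rho_rho] <;> ring)
    (fun x y y' => by ext <;> simp; ring)
    (fun c x y => by
      rw [smul_def]
      ext <;> simp [form_rho_right, hL.out.rho_rho, starRingEnd_apply] <;> ring)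

theorem hermitian_apply (x y : L) :
    L.hermitian x y = ⟨-L.form x (L.rho y), L.form x y⟩ := rfl

theorem hermitian_im (x y : L) : (L.hermitian x y).im = L.form x y := rfl

theorem hermitian_skew (x y : L) : L.hermitian x y = -star (L.hermitian y x) := by
  rw [hermitian_apply, hermitian_apply]
  ext
  · simp [form_rho_right, L.form_symm x y, L.form_symm (L.rho x) y]
  · simp [L.form_symm x y]

theorem hermitian_eq_zero_of_form {x : L} {P : Submodule Eisenstein L}
    (hP : ∀ y ∈ P, L.form y x = 0) {y : L} (hy : y ∈ P) : L.hermitian y x = 0 := by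
  have h1 := hP _ (P.smul_mem ω hy)
  rw [ω_smul] at h1
  rw [hermitian_apply]
  ext
  · simp [form_rho_right, h1, hP y hy]
  · exact hP y hy

/-- An Eisenstein-linear functional is determined by its `ω`-coordinate. -/
theorem eq_of_im_eq {f g : L →ₗ[Eisenstein] Eisenstein} (hfg : ∀ x, (f x).im = (g x).im) :
    f = g := by
  ext x
  · have h1 := hfg (ω • x)
    simp only [map_smul, smul_eq_mul, QuadraticAlgebra.im_mul, ω_re, ω_im] at h1
    linarith [hfg x]
  · exact hfg x

/-- Triviality of `ρ` on the discriminant group says that `η` times any functional is represented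
by a vector, since `ρ⁻¹ - 1` is multiplication by `ω ^ 2 - 1 = -η`. -/
theorem exists_hermitian_eq_η_mul (lam : L →ₗ[Eisenstein] Eisenstein) :
    ∃ z, ∀ x, L.hermitian x z = η * lam x := by
  let φ : Module.Dual ℤ L := QuadraticAlgebra.imₗ (-1 : ℤ) (-1) ∘ₗ lam.restrictScalars ℤ
  have hφ : ∀ x, φ x = (lam x).im := fun _ => rfl
  obtain ⟨z, hz⟩ := discriminantAction_eq_id_iff.1 hL.out.trivial_on_discriminant φ
  have heq : L.hermitian.flip (-z) = η • lam := by
    refine eq_of_im_eq fun x => ?_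
    have h1 := hz x
    rw [hL.out.rho_symm, ← ω_smul] at h1
    simp only [hφ, map_sub, map_neg, map_smul, smul_eq_mul, QuadraticAlgebra.im_sub,
      QuadraticAlgebra.im_neg, QuadraticAlgebra.im_mul, ω_re, ω_im] at h1
    rw [LinearMap.flip_apply, hermitian_im, map_neg, L.form_symm, h1]
    simp only [LinearMap.smul_apply, smul_eq_mul, QuadraticAlgebra.im_mul, η_re, η_im]
    ring
  exact ⟨-z, fun x => congrArg (fun f => f x) heq⟩

instance : Module.Finite Eisenstein L :=
  Module.Finite.of_restrictScalars_finite ℤ Eisenstein L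

/-- `star c * c` is the norm of `c`, a nonzero integer. -/
theorem star_smul_smul (c : Eisenstein) (x : L) : star c • c • x = c.norm • x := by
  rw [smul_smul, star_mul_self, Int.cast_smul_eq_zsmul]

namespace IsotropicPlane

/-- An isotropic plane as a submodule over the Eisenstein integers. -/
def toEisensteinSubmodule (J : L.IsotropicPlane) : Submodule Eisenstein L where
  carrier := J.toSubmodule
  add_mem' := J.toSubmodule.add_mem
  zero_mem' := J.toSubmodule.zero_mem
  smul_mem' c x hx := by
    have h1 : L.rho x ∈ J.toSubmodule := by
      rw [← J.invariant]; exact ⟨x, hx, rfl⟩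
    exact J.toSubmodule.add_mem (J.toSubmodule.smul_mem _ hx) (J.toSubmodule.smul_mem _ h1)

theorem mem_of_smul_mem {J : L.IsotropicPlane} {c : Eisenstein} (hc : c ≠ 0) {x : L}
    (hx : c • x ∈ J.toEisensteinSubmodule) : x ∈ J.toEisensteinSubmodule := by
  have h1 := J.toEisensteinSubmodule.smul_mem (star c) hx
  rw [star_smul_smul] at h1
  exact J.saturated _ _ (norm_pos hc).ne' h1

instance : Module.IsTorsionFree Eisenstein L := by
  rw [Module.isTorsionFree_iff_smul_eq_zero]
  intro c x h
  by_contra hne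
  push Not at hne
  have h1 := star_smul_smul c x
  rw [h, smul_zero, eq_comm, smul_eq_zero] at h1
  exact h1.elim (norm_pos hne.1).ne' hne.2

instance (J : L.IsotropicPlane) :
    Module.IsTorsionFree Eisenstein (L ⧸ J.toEisensteinSubmodule) := by
  rw [Module.isTorsionFree_iff_smul_eq_zero]
  intro c q hq
  induction q using Submodule.Quotient.induction_on with
  | H x =>
    rw [← Submodule.Quotient.mk_smul, Submodule.Quotient.mk_eq_zero] at hq
    rw [Submodule.Quotient.mk_eq_zero]
    by_cases hc : c = 0
    · exact Or.inl hc
    · exact Or.inr (mem_of_smul_mem hc hq)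

/-- An isotropic plane is free of rank one over the Eisenstein integers, and its generator takes
the value `1` on some functional because the plane is saturated. -/
theorem exists_generator (J : L.IsotropicPlane) :
    ∃ (e : L) (lam : L →ₗ[Eisenstein] Eisenstein),
      (∀ x, x ∈ J.toSubmodule ↔ ∃ c : Eisenstein, c • e = x) ∧ lam e = 1 := by
  have hrank : Module.finrank Eisenstein J.toEisensteinSubmodule = 1 := by
    have h1 := Module.finrank_mul_finrank ℤ Eisenstein J.toEisensteinSubmodule
    rw [QuadraticAlgebra.finrank_eq_two] at h1
    have h2 : Module.finrank ℤ J.toEisensteinSubmodule = 2 := J.rank_eq_two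
    omega
  let b := Module.finBasisOfFinrankEq Eisenstein J.toEisensteinSubmodule hrank
  obtain ⟨s, hs⟩ := Module.projective_lifting_property J.toEisensteinSubmodule.mkQ LinearMap.id
    J.toEisensteinSubmodule.mkQ_surjective
  -- a splitting of `L → L / J` gives a projection `L → J`
  have hmem : ∀ x, ((LinearMap.id : L →ₗ[Eisenstein] L) - s ∘ₗ J.toEisensteinSubmodule.mkQ) x
      ∈ J.toEisensteinSubmodule := by
    intro x
    rw [← Submodule.Quotient.mk_eq_zero, ← Submodule.mkQ_apply, LinearMap.sub_apply, map_sub,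
      sub_eq_zero]
    exact (congrArg (fun g => g (J.toEisensteinSubmodule.mkQ x)) hs).symm
  refine ⟨b 0, b.coord 0 ∘ₗ (LinearMap.codRestrict _ _ hmem), fun x => ⟨fun hx => ?_, ?_⟩, ?_⟩
  · refine ⟨b.repr ⟨x, hx⟩ 0, ?_⟩
    have h1 := congrArg Subtype.val (b.sum_repr ⟨x, hx⟩)
    simpa using h1
  · rintro ⟨c, rfl⟩
    exact J.toEisensteinSubmodule.smul_mem c (b 0).2
  · have h1 : LinearMap.codRestrict J.toEisensteinSubmodule
        (LinearMap.id - s ∘ₗ J.toEisensteinSubmodule.mkQ) hmem (b 0 : L) = b 0 := by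
      ext
      simp [LinearMap.codRestrict_apply, (Submodule.Quotient.mk_eq_zero _).2 (b 0).2]
    rw [LinearMap.comp_apply, h1]
    simp

theorem exists_hyperbolicPair (J : L.IsotropicPlane) :
    ∃ e f ε, (ε = 1 ∨ ε = η) ∧ HyperbolicPair L.hermitian e f ε ∧
      ∀ x, x ∈ J.toSubmodule ↔ ∃ c : Eisenstein, c • e = x := by
  obtain ⟨e, lam, hJ, hlam⟩ := J.exists_generator
  obtain ⟨z, hz⟩ := exists_hermitian_eq_η_mul lam
  have he : e ∈ J.toEisensteinSubmodule := (hJ e).2 ⟨1, one_smul _ e⟩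
  obtain ⟨f, ε, hε, H⟩ := _root_.exists_hyperbolicPair hermitian_skew
    (hermitian_eq_zero_of_form (fun y hy => J.isotropic y hy e he) he) lam hlam z hz
  exact ⟨e, f, ε, hε, H, hJ⟩

end IsotropicPlane

end
end RhoLattice

/-! ### Isomorphisms and orthogonal summands -/

namespace RhoLattice
open Eisenstein

/-- The inverse of an isomorphism. -/
def Iso.symm {L : RhoLattice.{u}} {M : RhoLattice.{v}} (φ : Iso L M) : Iso M L where
  toEquiv := φ.toEquiv.symm
  map_form x y := by
    simpa using (φ.map_form (φ.toEquiv.symm x) (φ.toEquiv.symm y)).symm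
  map_rho x := by
    apply φ.toEquiv.injective
    simp [φ.map_rho]

theorem IsEStar.of_iso {L : RhoLattice.{u}} {M : RhoLattice.{v}} (hL : L.IsEStar) (φ : Iso L M) :
    M.IsEStar where
  nondegenerate := by
    refine ⟨fun x hx => ?_, fun y hy => ?_⟩
    · have h1 := hL.nondegenerate.1 (φ.toEquiv.symm x) fun y => by
        rw [← φ.map_form, LinearEquiv.apply_symm_apply]; exact hx _
      simpa using h1
    · have h1 := hL.nondegenerate.2 (φ.toEquiv.symm y) fun x => by
        rw [← φ.map_form, LinearEquiv.apply_symm_apply]; exact hy _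
      simpa using h1
  rho_cubed x := by
    obtain ⟨x, rfl⟩ := φ.toEquiv.surjective x
    rw [← φ.map_rho, ← φ.map_rho, ← φ.map_rho, hL.rho_cubed]
  eq_zero_of_fixed x hx := by
    obtain ⟨x, rfl⟩ := φ.toEquiv.surjective x
    rw [← φ.map_rho] at hx
    rw [hL.eq_zero_of_fixed x (φ.toEquiv.injective hx), map_zero]
  trivial_on_discriminant := by
    rw [discriminantAction_eq_id_iff]
    intro ψ
    obtain ⟨z, hz⟩ := discriminantAction_eq_id_iff.1 hL.trivial_on_discriminant
      (ψ ∘ₗ (φ.toEquiv : L →ₗ[ℤ] M))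
    refine ⟨φ.toEquiv z, fun y => ?_⟩
    obtain ⟨x, rfl⟩ := φ.toEquiv.surjective y
    rw [φ.map_form, hz]
    have h1 : φ.toEquiv (L.rho.symm x) = M.rho.symm (φ.toEquiv x) := by
      rw [LinearEquiv.eq_symm_apply, ← φ.map_rho, LinearEquiv.apply_symm_apply]
    simp [h1]

variable {L : RhoLattice.{u}}

/-- An invariant orthogonal summand of an `𝓔^*`-lattice is an `𝓔^*`-lattice: functionals extend
by zero, and the vectors representing them can be projected. -/
theorem IsEStar.sub_of_isOrthogonalSum (hL : L.IsEStar) {P Q : Submodule ℤ L}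
    (hPQ : L.IsOrthogonalSum P Q) (hP : P.map (L.rho : L →ₗ[ℤ] L) = P) :
    (L.sub P hP).IsEStar := by
  obtain ⟨hc, horth⟩ := hPQ
  have hdec : ∀ x : L, ∃ p ∈ P, ∃ q ∈ Q, p + q = x := fun x =>
    Submodule.mem_sup.1 (hc.sup_eq_top ▸ Submodule.mem_top)
  have hnd : ∀ x ∈ P, (∀ y ∈ P, L.form x y = 0) → x = 0 := fun x hx h0 =>
    hL.nondegenerate.1 x fun y => by
      obtain ⟨p, hp, q, hq, rfl⟩ := hdec y
      rw [map_add, h0 p hp, horth x hx q hq, add_zero]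
  refine ⟨⟨fun (x : P) hx => ?_, fun (x : P) hx => ?_⟩,
    fun (x : P) => Subtype.ext (hL.rho_cubed x), fun (x : P) hx => ?_, ?_⟩
  · exact Subtype.ext (hnd x x.2 fun y hy => hx ⟨y, hy⟩)
  · exact Subtype.ext (hnd x x.2 fun y hy => (L.form_symm x y).trans (hx ⟨y, hy⟩))
  · exact Subtype.ext (hL.eq_zero_of_fixed x (congrArg Subtype.val hx))
  · rw [discriminantAction_eq_id_iff]
    intro (φ : P →ₗ[ℤ] ℤ)
    let π : L →ₗ[ℤ] P := P.projectionOnto Q hc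
    have hπ : ∀ x : P, π x = x := P.projectionOnto_apply_left hc
    obtain ⟨z, hz⟩ := discriminantAction_eq_id_iff.1 hL.trivial_on_discriminant (φ ∘ₗ π)
    obtain ⟨p, hp, q, hq, rfl⟩ := hdec z
    refine ⟨(⟨p, hp⟩ : P), fun (x : P) => ?_⟩
    have h1 := hz (x : L)
    have h2 : L.rho.symm (x : L) = (show P from (L.sub P hP).rho.symm x : P) := by
      rw [LinearEquiv.symm_apply_eq]
      exact congrArg Subtype.val ((L.sub P hP).rho.apply_symm_apply x).symm
    rw [map_add, LinearMap.add_apply, L.form_symm q, horth x x.2 q hq, add_zero, h2,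
      LinearMap.comp_apply, LinearMap.comp_apply, hπ, hπ] at h1
    exact h1

theorem IsOrthogonalSum.symm {P Q : Submodule ℤ L} (hPQ : L.IsOrthogonalSum P Q) :
    L.IsOrthogonalSum Q P :=
  ⟨hPQ.1.symm, fun x hx y hy => (L.form_symm x y).trans (hPQ.2 y hy x hx)⟩

variable [hL : Fact L.IsEStar]

theorem map_rho_restrictScalars (P : Submodule Eisenstein L) :
    (P.restrictScalars ℤ).map (L.rho : L →ₗ[ℤ] L) = P.restrictScalars ℤ := by
  apply le_antisymm
  · rintro _ ⟨x, hx, rfl⟩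
    have h1 := P.smul_mem ω hx
    rwa [ω_smul] at h1
  · intro x hx
    have h1 := P.smul_mem ω (P.smul_mem ω hx)
    rw [ω_smul, ω_smul] at h1
    exact ⟨L.rho (L.rho x), h1, hL.out.rho_cubed x⟩

/-- A submodule over the Eisenstein integers as a lattice with isometry. -/
def subEisenstein (P : Submodule Eisenstein L) : RhoLattice.{u} :=
  L.sub (P.restrictScalars ℤ) (map_rho_restrictScalars P)

end RhoLattice

/-! ### The splitting given by a hyperbolic pair -/

section Splitting

open RhoLattice Eisenstein

namespace HyperbolicPair

variable {L : RhoLattice.{u}} [hL : Fact L.IsEStar] {e f : L} {ε : Eisenstein}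

/-- The hyperbolic plane spanned by `e` and `f`. -/
def plane (e f : L) : Submodule Eisenstein L := Submodule.span Eisenstein {e, f}

theorem isOrthogonalSum (H : HyperbolicPair L.hermitian e f ε) (hε : ε ≠ 0) :
    L.IsOrthogonalSum ((plane e f).restrictScalars ℤ)
      ((complement L.hermitian e f).restrictScalars ℤ) := by
  have hbij := H.coordMap_bijective hermitian_skew hε
  refine ⟨⟨?_, ?_⟩, ?_⟩
  · rw [Submodule.disjoint_def]
    intro x hx hx'
    obtain ⟨a, b, rfl⟩ := Submodule.mem_span_pair.1 hx
    have h1 : coordMap L.hermitian e f (a, b, 0) = coordMap L.hermitian e f (0, 0, ⟨_, hx'⟩) := by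
      simp [coordMap_apply]
    have h2 := congrArg (fun p => (p.2.2 : L)) (hbij.1 h1)
    exact h2.symm
  · rw [codisjoint_iff, eq_top_iff]
    rintro x -
    obtain ⟨⟨a, b, k⟩, rfl⟩ := hbij.2 x
    rw [coordMap_apply, ← add_assoc]
    exact Submodule.add_mem_sup (Submodule.mem_span_pair.2 ⟨a, b, rfl⟩) k.2
  · intro x hx y hy
    obtain ⟨a, b, rfl⟩ := Submodule.mem_span_pair.1 hx
    have h1 := mem_complement.1 hy
    have h2 : L.hermitian (a • e + b • f) y = 0 := by
      simp [hermitian_skew e y, hermitian_skew f y, h1.1, h1.2]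
    rw [← hermitian_im, h2, QuadraticAlgebra.im_zero]

/-- The hyperbolic plane is isomorphic to any lattice on `ℤ ^ 4` which in coordinates from
`ℤ[ω] ^ 2` has the hyperbolic form scaled by `ε` and multiplication by `ω` as isometry. -/
theorem nonempty_iso_plane (H : HyperbolicPair L.hermitian e f ε) (hε : ε ≠ 0)
    {G R : Matrix (Fin 4) (Fin 4) ℤ} {hG : G.transpose = G} {hR : R * (R * R) = 1}
    {hGR : R.transpose * G * R = G} (F : (Fin 4 → ℤ) ≃ₗ[ℤ] Eisenstein × Eisenstein)
    (hform : ∀ v w, Matrix.toBilin' G v w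
      = ((F v).1 * star (F w).2 * ε - (F v).2 * star (F w).1 * star ε).im)
    (hrho : ∀ v, F (Matrix.toLin' R v) = ω • F v) :
    Nonempty (Iso (subEisenstein (plane e f)) (ofMatrix G R hG hR hGR)) := by
  have hbij := H.coordMap_bijective hermitian_skew hε
  let g : Eisenstein × Eisenstein →ₗ[Eisenstein] L :=
    (LinearMap.toSpanSingleton Eisenstein L e).coprod (LinearMap.toSpanSingleton Eisenstein L f)
  have hg : ∀ p, g p = p.1 • e + p.2 • f := fun _ => rfl
  have hg' : ∀ p, g p = coordMap L.hermitian e f (p.1, p.2, 0) := fun p => by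
    simp [coordMap_apply, hg]
  have hmem : ∀ p, g p ∈ plane e f := fun p => Submodule.mem_span_pair.2 ⟨p.1, p.2, rfl⟩
  let E : (Eisenstein × Eisenstein) ≃ₗ[Eisenstein] plane e f :=
    LinearEquiv.ofBijective (g.codRestrict _ hmem) (by
      constructor
      · intro p q hpq
        have h1 : g p = g q := congrArg Subtype.val hpq
        rw [hg', hg'] at h1
        have h2 := hbij.1 h1
        exact Prod.ext (congrArg (fun x => x.1) h2) (congrArg (fun x => x.2.1) h2)
      · rintro ⟨x, hx⟩
        obtain ⟨a, b, rfl⟩ := Submodule.mem_span_pair.1 hx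
        exact ⟨(a, b), rfl⟩)
  have hE : ∀ p, (E p : L) = g p := fun _ => rfl
  refine ⟨Iso.symm (L := ofMatrix G R hG hR hGR)
    ⟨F.trans (E.restrictScalars ℤ), fun (v w : Fin 4 → ℤ) => ?_, fun (v : Fin 4 → ℤ) => ?_⟩⟩
  · change L.form (E (F v) : L) (E (F w) : L) = Matrix.toBilin' G v w
    rw [hform, ← hermitian_im, hE, hE, hg', hg', H.apply_coordMap hermitian_skew]
    simp
  · refine Subtype.ext ?_
    change (E (F (Matrix.toLin' R v)) : L) = L.rho (E (F v) : L)
    rw [hrho, map_smul, ← ω_smul]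
    rfl

theorem nonempty_iso_latticeUU (H : HyperbolicPair L.hermitian e f 1) :
    Nonempty (Iso (subEisenstein (plane e f)) latticeUU) := by
  -- `e₁ = e`, `e₂ = ω e`, `f₁ = -ω f`, `f₂ = f`
  let F : (Fin 4 → ℤ) ≃ₗ[ℤ] Eisenstein × Eisenstein :=
    { toFun := fun v => (⟨v 0, v 2⟩, ⟨v 3, -v 1⟩)
      invFun := fun p => ![p.1.re, -p.2.im, p.1.im, p.2.re]
      map_add' := fun v w => by ext <;> simp; ring
      map_smul' := fun n v => by ext <;> simp
      left_inv := fun v => by ext i; fin_cases i <;> simp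
      right_inv := fun p => by ext <;> simp }
  have hF : ∀ v : Fin 4 → ℤ, F v = (⟨v 0, v 2⟩, ⟨v 3, -v 1⟩) := fun _ => rfl
  refine H.nonempty_iso_plane one_ne_zero F (fun v w => ?_) (fun v => ?_)
  · rw [hF, hF, Matrix.toBilin'_apply]
    simp [Fin.sum_univ_four, gramUU]
    ring
  · rw [hF, hF]
    ext <;> simp [Matrix.toLin'_apply, Matrix.mulVec, dotProduct, Fin.sum_univ_four]

theorem nonempty_iso_latticeUU3 (H : HyperbolicPair L.hermitian e f η) :
    Nonempty (Iso (subEisenstein (plane e f)) latticeUU3) := by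
  -- `e₁ = e`, `e₂' = (1 - ω) e`, `f₁ = f`, `f₂' = -(2 + ω) f`
  let F : (Fin 4 → ℤ) ≃ₗ[ℤ] Eisenstein × Eisenstein :=
    { toFun := fun v => (⟨v 0 + v 2, -v 2⟩, ⟨v 1 - 2 * v 3, -v 3⟩)
      invFun := fun p => ![p.1.re + p.1.im, p.2.re - 2 * p.2.im, -p.1.im, -p.2.im]
      map_add' := fun v w => by ext <;> simp <;> ring
      map_smul' := fun n v => by ext <;> simp <;> ring
      left_inv := fun v => by ext i; fin_cases i <;> simp
      right_inv := fun p => by ext <;> simp }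
  have hF : ∀ v : Fin 4 → ℤ, F v = (⟨v 0 + v 2, -v 2⟩, ⟨v 1 - 2 * v 3, -v 3⟩) := fun _ => rfl
  refine H.nonempty_iso_plane η_ne_zero F (fun v w => ?_) (fun v => ?_)
  · rw [hF, hF, Matrix.toBilin'_apply]
    simp [Fin.sum_univ_four, gramUU]
    ring
  · rw [hF, hF]
    ext <;> simp [Matrix.toLin'_apply, Matrix.mulVec, dotProduct, Fin.sum_univ_four] <;> ring

theorem complement_le_perp {J : L.IsotropicPlane}
    (hJ : ∀ x, x ∈ J.toSubmodule ↔ ∃ c : Eisenstein, c • e = x) :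
    (complement L.hermitian e f).restrictScalars ℤ ≤ J.perp := by
  intro k hk y hy
  obtain ⟨c, rfl⟩ := (hJ y).1 hy
  have h1 : L.hermitian (c • e) k = 0 := by
    rw [map_smul, LinearMap.smul_apply, hermitian_skew, (mem_complement.1 hk).1]
    simp
  rw [← hermitian_im, h1, QuadraticAlgebra.im_zero]

/-- In the coordinates `(a, b, k)` the plane `J = ℤ[ω] e` is `b = k = 0` and `J^⊥` is `b = 0`. -/
theorem toPerpQuotient_bijective (H : HyperbolicPair L.hermitian e f ε) (hε : ε ≠ 0)
    {J : L.IsotropicPlane} (hJ : ∀ x, x ∈ J.toSubmodule ↔ ∃ c : Eisenstein, c • e = x) :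
    Function.Bijective (J.toPerpQuotient _ (complement_le_perp (f := f) hJ)) := by
  have hbij := H.coordMap_bijective hermitian_skew hε
  constructor
  · rw [← LinearMap.ker_eq_bot, LinearMap.ker_eq_bot']
    rintro ⟨k, hk⟩ h0
    have h1 : k ∈ J.toSubmodule := (Submodule.Quotient.mk_eq_zero J.inPerp).1 h0
    obtain ⟨c, rfl⟩ := (hJ k).1 h1
    have h2 := (mem_complement.1 hk).2
    rw [map_smul, LinearMap.smul_apply, H.pairing, smul_eq_mul] at h2
    have hc : c = 0 := (mul_eq_zero.1 h2).resolve_right hε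
    subst hc
    exact Subtype.ext (zero_smul _ _)
  · intro q
    obtain ⟨⟨x, hx⟩, rfl⟩ := Submodule.Quotient.mk_surjective _ q
    obtain ⟨⟨a, b, k⟩, rfl⟩ := hbij.2 x
    have he : e ∈ J.toEisensteinSubmodule := (hJ e).2 ⟨1, one_smul _ e⟩
    have h1 : L.hermitian e (coordMap L.hermitian e f (a, b, k)) = 0 :=
      hermitian_eq_zero_of_form (P := J.toEisensteinSubmodule) hx he
    have h2 : L.hermitian e (coordMap L.hermitian e f (a, b, k)) = star b * ε := by
      have := H.apply_coordMap hermitian_skew (1, 0, 0) (a, b, k)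
      simpa [coordMap_apply (1, 0, 0)] using this
    have hb : b = 0 := by
      rw [h2] at h1
      exact star_eq_zero.1 ((mul_eq_zero.1 h1).resolve_right hε)
    subst hb
    refine ⟨k, ?_⟩
    refine ((Submodule.Quotient.eq _).2 ?_)
    change (k : L) - coordMap L.hermitian e f (a, 0, k) ∈ J.toSubmodule
    exact (hJ _).2 ⟨-a, by simp [coordMap_apply]⟩

/-- The natural isomorphism from the complement of a hyperbolic pair to `J^⊥ / J`. -/
noncomputable def isoPerpQuotient (H : HyperbolicPair L.hermitian e f ε) (hε : ε ≠ 0)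
    {J : L.IsotropicPlane} (hJ : ∀ x, x ∈ J.toSubmodule ↔ ∃ c : Eisenstein, c • e = x) :
    Iso (subEisenstein (complement L.hermitian e f)) J.perpQuotient where
  toEquiv := LinearEquiv.ofBijective _ (H.toPerpQuotient_bijective hε hJ)
  map_form _ _ := rfl
  map_rho _ := rfl

end HyperbolicPair

end Splitting

/-! ### Gluing isometries -/

/-- If `B (σ x) (σ y) = B (D x) y` for a non-degenerate form `B` and an automorphism `σ`, then `D` is
surjective: cancelling `det B` leaves `det D = (det σ) ^ 2`, a unit. -/
theorem LinearMap.BilinForm.surjective_of_apply_equiv_eq {M : Type*} [AddCommGroup M]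
    [Module.Free ℤ M] [Module.Finite ℤ M] {B : LinearMap.BilinForm ℤ M} (hB : B.Nondegenerate)
    (σ : M ≃ₗ[ℤ] M) (D : M →ₗ[ℤ] M) (h : ∀ x y, B (σ x) (σ y) = B (D x) y) :
    Function.Surjective D := by
  classical
  let b := Module.Free.chooseBasis ℤ M
  have h1 : B.comp (σ : M →ₗ[ℤ] M) (σ : M →ₗ[ℤ] M) = B.compLeft D :=
    LinearMap.ext₂ h
  have h2 := congrArg (fun C => (LinearMap.BilinForm.toMatrix b C).det) h1
  simp only [LinearMap.BilinForm.toMatrix_comp b b, LinearMap.BilinForm.toMatrix_compLeft,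
    Matrix.det_mul, Matrix.det_transpose, LinearMap.det_toMatrix] at h2
  have h3 := (LinearMap.BilinForm.nondegenerate_iff_det_ne_zero b).1 hB
  have h4 : LinearMap.det (σ : M →ₗ[ℤ] M) * LinearMap.det (σ : M →ₗ[ℤ] M) = LinearMap.det D := by
    refine mul_right_cancel₀ h3 ?_
    rw [← h2]; ring
  have h5 : IsUnit (LinearMap.det D) := h4 ▸ σ.isUnit_det'.mul σ.isUnit_det'
  exact ((Module.End.isUnit_iff _).1 ((LinearMap.isUnit_iff_isUnit_det D).2 h5)).2

section Gluing

open RhoLattice Eisenstein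

namespace RhoLattice

variable {L : RhoLattice.{u}} [hL : Fact L.IsEStar]

/-- An isomorphism of invariant sublattices is Eisenstein-linear and preserves the skew-hermitian
form. -/
theorem Iso.exists_linearEquiv {P Q : Submodule Eisenstein L}
    (φ : Iso (subEisenstein P) (subEisenstein Q)) :
    ∃ ψ : P ≃ₗ[Eisenstein] Q, ∀ k l, L.hermitian (ψ k) (ψ l) = L.hermitian k l := by
  let ψ : P ≃+ Q := φ.toEquiv.toAddEquiv
  have hrho : ∀ k l : P, (l : L) = L.rho k → (ψ l : L) = L.rho (ψ k) := fun k l hl =>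
    (congrArg (fun x => (ψ x : L)) (Subtype.ext hl)).trans (congrArg Subtype.val (φ.map_rho k))
  have hform : ∀ k l : P, L.form (ψ k) (ψ l) = L.form k l := φ.map_form
  have hω : ∀ k : P, ψ (ω • k) = ω • ψ k := fun k => Subtype.ext (by
    rw [hrho k (ω • k) (ω_smul _), Submodule.coe_smul, ω_smul])
  have hsmul : ∀ (c : Eisenstein) (k : P), ψ (c • k) = c • ψ k := fun c k => by
    have hc : c = (c.re : Eisenstein) + (c.im : Eisenstein) * ω := by ext <;> simp
    rw [hc, add_smul, add_smul, mul_smul, mul_smul, Int.cast_smul_eq_zsmul,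
      Int.cast_smul_eq_zsmul, Int.cast_smul_eq_zsmul, Int.cast_smul_eq_zsmul, map_add, map_zsmul,
      map_zsmul, hω]
  refine ⟨{ ψ with map_smul' := hsmul }, fun k l => ?_⟩
  change L.hermitian (ψ k) (ψ l) = _
  rw [hermitian_apply, hermitian_apply, hform, ← hrho l (ω • l) (ω_smul _), hform,
    Submodule.coe_smul, ω_smul]

end RhoLattice

namespace HyperbolicPair

variable {L : RhoLattice.{u}} [hL : Fact L.IsEStar] {e f e' f' : L}

/-- Two hyperbolic pairs with isomorphic complements cannot be of the two different types: the
discriminants of `L` computed from them would differ by the factor `9`. -/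
theorem false_of_iso (H : HyperbolicPair L.hermitian e f 1)
    (H' : HyperbolicPair L.hermitian e' f' η)
    {ψ : complement L.hermitian e f ≃ₗ[Eisenstein] complement L.hermitian e' f'}
    (hψ : ∀ k l, L.hermitian (ψ k) (ψ l) = L.hermitian k l) : False := by
  let Ψ := H.coordEquiv hermitian_skew one_ne_zero
  have hΨ : ∀ p, Ψ p = coordMap L.hermitian e f p := fun _ => rfl
  -- the glued automorphism pulls `h x y` back to `h (D x) y`, where `D` multiplies `e` by `η` and
  -- `f` by `star η`
  let D : L →ₗ[Eisenstein] L := Ψ.toLinearMap ∘ₗ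
    (LinearMap.prodMap (η • LinearMap.id) (LinearMap.prodMap (star η • LinearMap.id)
      LinearMap.id)) ∘ₗ Ψ.symm.toLinearMap
  have hD : ∀ a b k, D (Ψ (a, b, k)) = Ψ (η * a, star η * b, k) := fun a b k => by simp [D]
  have hsurj := LinearMap.BilinForm.surjective_of_apply_equiv_eq hL.out.nondegenerate
    ((glue hermitian_skew H H' one_ne_zero η_ne_zero ψ).restrictScalars ℤ)
    (D.restrictScalars ℤ) (fun x y => by
      obtain ⟨⟨a, b, k⟩, rfl⟩ := Ψ.surjective x
      obtain ⟨q, rfl⟩ := Ψ.surjective y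
      rw [LinearMap.restrictScalars_apply, hD, LinearEquiv.restrictScalars_apply,
        LinearEquiv.restrictScalars_apply, ← hermitian_im, ← hermitian_im, hΨ, hΨ, hΨ,
        apply_glue hermitian_skew H H' _ _ hψ, H.apply_coordMap hermitian_skew]
      refine congrArg QuadraticAlgebra.im ?_
      dsimp only
      rw [star_one]
      ring)
  obtain ⟨x, hx⟩ := hsurj (Ψ (0, 1, 0))
  obtain ⟨⟨a, b, k⟩, rfl⟩ := Ψ.surjective x
  rw [LinearMap.restrictScalars_apply, hD] at hx
  have h1 := congrArg (fun p => p.2.1) (Ψ.injective hx)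
  exact not_isUnit_star_η (IsUnit.of_mul_eq_one b h1)

end HyperbolicPair

end Gluing

/-! ### Orbits of isotropic planes -/

section Orbits

open Eisenstein

namespace RhoLattice.IsotropicPlane

open HyperbolicPair

/-- The lattice `J^⊥ / J` only depends on the orbit of `J`. -/
theorem nonempty_iso_smul {L : RhoLattice.{u}} (g : L.isometryGroup) (J : L.IsotropicPlane) :
    Nonempty (Iso J.perpQuotient (g • J).perpQuotient) := by
  have hperp : J.perp.map ((g : L ≃ₗ[ℤ] L) : L →ₗ[ℤ] L) = (g • J).perp := by
    ext x
    constructor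
    · rintro ⟨x, hx, rfl⟩ _ ⟨y, hy, rfl⟩
      exact (g.2.1 y x).trans (hx y hy)
    · intro hx
      refine ⟨(g : L ≃ₗ[ℤ] L).symm x, fun y hy => ?_, by simp⟩
      have h1 := hx _ ⟨y, hy, rfl⟩
      have h2 := g.2.1 y ((g : L ≃ₗ[ℤ] L).symm x)
      rw [LinearEquiv.apply_symm_apply] at h2
      exact h2.symm.trans h1
  let E : J.perp ≃ₗ[ℤ] (g • J).perp := (g : L ≃ₗ[ℤ] L).ofSubmodules _ _ hperp
  have hE : ∀ x, (E x : L) = (g : L ≃ₗ[ℤ] L) x := fun _ => rfl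
  have hin : J.inPerp.map (E : J.perp →ₗ[ℤ] (g • J).perp) = (g • J).inPerp := by
    ext x
    constructor
    · rintro ⟨x, hx, rfl⟩
      exact ⟨x, hx, rfl⟩
    · rintro ⟨y, hy, hyx⟩
      exact ⟨⟨y, fun z hz => J.isotropic z hz y hy⟩, hy, Subtype.ext hyx⟩
  refine ⟨⟨Submodule.Quotient.equiv J.inPerp (g • J).inPerp E hin, fun p q => ?_, fun p => ?_⟩⟩
  · obtain ⟨x, rfl⟩ := Submodule.Quotient.mk_surjective _ p
    obtain ⟨y, rfl⟩ := Submodule.Quotient.mk_surjective _ q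
    exact g.2.1 x y
  · obtain ⟨x, rfl⟩ := Submodule.Quotient.mk_surjective _ p
    exact congrArg (Submodule.Quotient.mk (p := (g • J).inPerp)) (Subtype.ext (g.2.2 x))

/-- Planes with isomorphic quotients `J^⊥ / J` are equivalent: their hyperbolic pairs are of the
same type, and the isomorphism of the complements extends to an isometry of `L`. -/
theorem exists_smul_eq_of_iso {L : RhoLattice.{u}} [Fact L.IsEStar] {J J' : L.IsotropicPlane}
    (φ : Iso J.perpQuotient J'.perpQuotient) : ∃ g : L.isometryGroup, g • J = J' := by
  obtain ⟨e, f, ε, hε, H, hJ⟩ := J.exists_hyperbolicPair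
  obtain ⟨e', f', ε', hε', H', hJ'⟩ := J'.exists_hyperbolicPair
  have hne : ε ≠ 0 := by
    rcases hε with rfl | rfl; exacts [one_ne_zero, η_ne_zero]
  have hne' : ε' ≠ 0 := by
    rcases hε' with rfl | rfl; exacts [one_ne_zero, η_ne_zero]
  obtain ⟨χ⟩ : Nonempty (Iso (subEisenstein (complement L.hermitian e f))
      (subEisenstein (complement L.hermitian e' f'))) :=
    isomorphic_equivalence.trans ⟨H.isoPerpQuotient hne hJ⟩
      (isomorphic_equivalence.trans ⟨φ⟩ ⟨(H'.isoPerpQuotient hne' hJ').symm⟩)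
  obtain ⟨ψ, hψ⟩ := χ.exists_linearEquiv
  have heq : ε = ε' := by
    rcases hε with rfl | rfl <;> rcases hε' with rfl | rfl
    · rfl
    · exact (false_of_iso H H' hψ).elim
    · refine (false_of_iso H' H (ψ := ψ.symm) fun k l => ?_).elim
      rw [← hψ, ψ.apply_symm_apply, ψ.apply_symm_apply]
    · rfl
  subst heq
  let σ := glue hermitian_skew H H' hne hne' ψ
  have hform : ∀ x y, L.form (σ x) (σ y) = L.form x y := fun x y => by
    obtain ⟨p, rfl⟩ := (H.coordMap_bijective hermitian_skew hne).2 x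
    obtain ⟨q, rfl⟩ := (H.coordMap_bijective hermitian_skew hne).2 y
    rw [← hermitian_im, ← hermitian_im, apply_glue hermitian_skew H H' hne hne' hψ,
      H.apply_coordMap hermitian_skew]
  have hrho : ∀ x, σ (L.rho x) = L.rho (σ x) := fun x => by
    rw [← ω_smul, ← ω_smul, map_smul]
  have hσ : ∀ c : Eisenstein, σ (c • e) = c • e' := fun c => by
    have h1 := glue_coordMap hermitian_skew H H' hne hne' (ψ := ψ) (c, 0, 0)
    rw [coordMap_apply, coordMap_apply] at h1
    simpa using h1
  refine ⟨⟨σ.restrictScalars ℤ, hform, hrho⟩, ext' ?_⟩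
  ext x
  rw [hJ']
  constructor
  · rintro ⟨y, hy, rfl⟩
    obtain ⟨c, rfl⟩ := (hJ y).1 hy
    exact ⟨c, (hσ c).symm⟩
  · rintro ⟨c, rfl⟩
    exact ⟨c • e, (hJ _).2 ⟨c, rfl⟩, hσ c⟩

/-- The splitting of `L` by a hyperbolic pair containing a generator of `J`. -/
theorem exists_isOrthogonalSum {L : RhoLattice.{u}} [hL : Fact L.IsEStar] (J : L.IsotropicPlane) :
    ∃ (H K : Submodule ℤ L)
        (hH : H.map (L.rho : L →ₗ[ℤ] L) = H) (hK : K.map (L.rho : L →ₗ[ℤ] L) = K),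
        L.IsOrthogonalSum H K ∧
        (L.sub H hH).IsEStar ∧ (L.sub K hK).IsEStar ∧
        (Nonempty (RhoLattice.Iso (L.sub H hH) RhoLattice.latticeUU) ∨
          Nonempty (RhoLattice.Iso (L.sub H hH) RhoLattice.latticeUU3)) ∧
        J.toSubmodule ≤ H ∧
        ∃ (hKJ : K ≤ J.perp) (φ : RhoLattice.Iso (L.sub K hK) J.perpQuotient),
          ∀ x : K, φ.toEquiv x = J.toPerpQuotient K hKJ x := by
  obtain ⟨e, f, ε, hε, H, hJ⟩ := J.exists_hyperbolicPair
  have hne : ε ≠ 0 := by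
    rcases hε with rfl | rfl; exacts [one_ne_zero, η_ne_zero]
  have hsum := H.isOrthogonalSum hne
  refine ⟨_, _, map_rho_restrictScalars (plane e f),
    map_rho_restrictScalars (complement L.hermitian e f), hsum,
    hL.out.sub_of_isOrthogonalSum hsum _, hL.out.sub_of_isOrthogonalSum hsum.symm _, ?_, ?_,
    complement_le_perp hJ, H.isoPerpQuotient hne hJ, fun _ => rfl⟩
  · rcases hε with rfl | rfl
    · exact Or.inl H.nonempty_iso_latticeUU
    · exact Or.inr H.nonempty_iso_latticeUU3
  · intro x hx
    obtain ⟨c, rfl⟩ := (hJ x).1 hx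
    exact (plane e f).smul_mem c (Submodule.subset_span (Set.mem_insert _ _))

end RhoLattice.IsotropicPlane

end Orbits

theorem mainTheorem4 (T : RhoLattice.{u}) (hT : T.IsEStar) :
    (∀ J : T.IsotropicPlane,
      J.perpQuotient.IsEStar ∧
      ∃ (H K : Submodule ℤ T)
        (hH : H.map (T.rho : T →ₗ[ℤ] T) = H) (hK : K.map (T.rho : T →ₗ[ℤ] T) = K),
        T.IsOrthogonalSum H K ∧
        (T.sub H hH).IsEStar ∧ (T.sub K hK).IsEStar ∧
        (Nonempty (RhoLattice.Iso (T.sub H hH) RhoLattice.latticeUU) ∨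
          Nonempty (RhoLattice.Iso (T.sub H hH) RhoLattice.latticeUU3)) ∧
        J.toSubmodule ≤ H ∧
        ∃ (hKJ : K ≤ J.perp) (φ : RhoLattice.Iso (T.sub K hK) J.perpQuotient),
          ∀ x : K, φ.toEquiv x = J.toPerpQuotient K hKJ x) ∧
    ∃ F : MulAction.orbitRel.Quotient T.isometryGroup T.IsotropicPlane ≃
        {c : RhoLattice.IsoClass.{u} // ∃ J : T.IsotropicPlane, J.perpQuotient.isoClass = c},
      ∀ J : T.IsotropicPlane,
        (F (Quotient.mk _ J) : RhoLattice.IsoClass.{u}) = J.perpQuotient.isoClass := by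
  have : Fact T.IsEStar := ⟨hT⟩
  refine ⟨fun J => ?_, ?_⟩
  · obtain ⟨H, K, hH, hK, hsum, hHE, hKE, hiso, hJH, hKJ, φ, hφ⟩ := J.exists_isOrthogonalSum
    exact ⟨hKE.of_iso φ, H, K, hH, hK, hsum, hHE, hKE, hiso, hJH, hKJ, φ, hφ⟩
  · let F₀ : MulAction.orbitRel.Quotient T.isometryGroup T.IsotropicPlane →
        {c : RhoLattice.IsoClass.{u} // ∃ J : T.IsotropicPlane, J.perpQuotient.isoClass = c} :=
      Quotient.lift (fun J => ⟨J.perpQuotient.isoClass, J, rfl⟩) (by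
        rintro _ J ⟨g, rfl⟩
        exact Subtype.ext (Quotient.sound
          (RhoLattice.isomorphic_equivalence.symm (RhoLattice.IsotropicPlane.nonempty_iso_smul g J))))
    refine ⟨Equiv.ofBijective F₀ ⟨?_, ?_⟩, fun _ => rfl⟩
    · intro p q hpq
      induction p using Quotient.inductionOn with
      | h J =>
        induction q using Quotient.inductionOn with
        | h J' =>
          obtain ⟨φ⟩ := Quotient.exact (congrArg Subtype.val hpq.symm)
          exact Quotient.sound (RhoLattice.IsotropicPlane.exists_smul_eq_of_iso φ)
    · rintro ⟨_, J, rfl⟩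
      exact ⟨Quotient.mk _ J, rfl⟩
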